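/- Let $\Sigma$ be a signature (finitary operation symbols only) containing a constant symbol $\top$, and let $\mathbf K$ be a class of $\Sigma$-structures. For a $\Sigma$-structure $A$ let $Co_{\mathbf K}(A)$ be the set of congruences $\theta$ of $A$ with $A/\theta\in\mathbf K$, ordered by inclusion. Let $(Co_{\mathbf K},i)$ be a congruence filter pair: $A\mapsto Co_{\mathbf K}(A)$, with $f\mapsto (f\times f)^{-1}$ on homomorphisms, is a contravariant functor to algebraic lattices (with maps preserving arbitrary infima and directed suprema as morphisms), and the maps $i_A:Co_{\mathbf K}(A)\to\mathcal P(A)$ preserve arbitrary infima and directed suprema and satisfy $i_A((f\times f)^{-1}\theta)=f^{-1}(i_B(\theta))$ for all homomorphisms $f:A\to B$ and all $\theta\in Co_{\mathbf K}(B)$. Assume that $i$ is given by the equation $\langle x,\top\rangle$, i.e. $i_A(\theta)=\{a\in A\mid \langle a,\top^A\rangle\in\theta\}$. Let $X$ be an infinite set of variables and let $l$ be the associated logic on the formula algebra $Fm(X)$: $\Gamma\vdash\varphi$ iff for all $\theta\in Co_{\mathbf K}(Fm(X))$, $\Gamma\subseteq i_{Fm(X)}(\theta)$ implies $\varphi\in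 i_{Fm(X)}(\theta)$. A subset $F\subseteq A$ is an $l$-filter if $\Gamma\vdash\varphi$ and $v[\Gamma]\subseteq F$ imply $v(\varphi)\in F$ for every homomorphism $v:Fm(X)\to A$; let $Fi_l(A)$ be the set of $l$-filters of $A$, ordered by inclusion (each $i_A(\theta)$ is an $l$-filter). Let $\Omega_A(F)$ be the greatest congruence $\theta$ of $A$ compatible with $F$ (i.e. $a\in F$ and $\langle a,b\rangle\in\theta$ imply $b\in F$). The logic $l$ is *protoalgebraic* if for every theory $T$ and $\langle\varphi,\psi\rangle\in\Omega_{Fm(X)}(T)$ one has $T,\varphi\vdash\psi$ and $T,\psi\vdash\varphi$. It is *truth-equational* if there is a set $\tau(x)$ of equations in one variable such that for every $\Sigma$-structure $A$ and every $F\in Fi_l(A)$ with $\Omega_A(F)$ the identity, $F$ is the set of solutions of $\tau$ in $A$. It is *regularly weakly algebraizable* if it is protoalgebraic and truth-equational, and there is a set $\Delta(x,y,\bar z)$ of formulas (with parameters $\bar z$) such that for every $\Sigma$-structure $A$, $F\in Fi_l(A)$ and $a,b\in A$: $\langle a,b\rangle\in\Omega_A(F)$ iff $\delta^A(a,b,\bar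 c)\in F$ for all $\delta\in\Delta$ and all $\bar c$ in $A$, and such that $x,y\vdash\delta(x,y,\bar z)$ for all $\delta\in\Delta$. **Theorem 4.14.** The logic $l$ is regularly weakly algebraizable if and only if $i$ is left adjoint to $\Omega$, i.e. for every $\Sigma$-structure $A$, every $\theta\in Co_{\mathbf K}(A)$ and every $F\in Fi_l(A)$, $$i_A(\theta)\subseteq F\iff\theta\subseteq\Omega_A(F).$$ In this case all maps $i_A:Co_{\mathbf K}(A)\to Fi_l(A)$ and all $\Omega_A$ on $Fi_l(A)$ are order preserving. In particular, if $\Omega_A(F)\in Co_{\mathbf K}(A)$ for all $A$ and all $F\in Fi_l(A)$, then $l$ is regularly weakly algebraizable if and only if, for every $A$, the maps $i_A:Co_{\mathbf K}(A)\to Fi_l(A)$ and $\Omega_A:Fi_l(A)\to Co_{\mathbf K}(A)$ form a Galois connection with $i_A$ as the left adjoint. -/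

import Mathlib

open scoped FirstOrder
open FirstOrder.Language (Term Structure Constants)

universe u v

/-! A signature is a first-order language `L` without relation symbols (`[L.IsAlgebraic]`),
a `Σ`-structure is a type with `[L.Structure A]`, homomorphisms are `A →[L] B`, and the set of
formulas with variables in `X` is `L.Term X`. -/

namespace AAL

variable {L : FirstOrder.Language.{u, v}}

/-- The absolutely free structure on the set of formulas with variables in `X`. -/
instance termStructure [L.IsAlgebraic] (X : Type u) : L.Structure (L.Term X) where
  funMap f ts := Term.func f ts
  RelMap r _ := isEmptyElim r

/-! ### Congruences -/

variable (L) in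
/-- A congruence of a structure `A`: an equivalence relation respecting all operations. -/
structure Congruence (A : Type u) [L.Structure A] extends Setoid A where
  map_fun : ∀ {n : ℕ} (f : L.Functions n) (x y : Fin n → A),
    (∀ k, toSetoid (x k) (y k)) → toSetoid (Structure.funMap f x) (Structure.funMap f y)

namespace Congruence

section

variable {A : Type u} [L.Structure A]

theorem toSetoid_injective :
    Function.Injective (Congruence.toSetoid : Congruence L A → Setoid A) := by
  rintro ⟨s, hs⟩ ⟨t, ht⟩ h
  cases h
  rfl

/-- Congruences are ordered by inclusion. -/
instance : PartialOrder (Congruence L A) :=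
  PartialOrder.lift Congruence.toSetoid toSetoid_injective

/-- `θ` is compatible with `F`: if `a ∈ F` and `a θ b`, then `b ∈ F`. -/
def Compatible (θ : Congruence L A) (F : Set A) : Prop :=
  ∀ a b, a ∈ F → θ.toSetoid a b → b ∈ F

/-- The quotient structure `A / θ` (on the type `Quotient θ.toSetoid`). -/
instance prestructure [L.IsAlgebraic] (θ : Congruence L A) : L.Prestructure θ.toSetoid where
  toStructure := inferInstance
  fun_equiv {_} {f} x y h := θ.map_fun f x y h
  rel_equiv {_} {r} _ _ _ := isEmptyElim r

/-- The quotient `A / θ` as a bundled structure. -/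
def quotient [L.IsAlgebraic] (θ : Congruence L A) : CategoryTheory.Bundled.{u} L.Structure :=
  CategoryTheory.Bundled.of (Quotient θ.toSetoid)

end

/-- The inverse image `(f × f)⁻¹(θ)` of a congruence under a homomorphism. -/
def comap {A B : Type u} [L.Structure A] [L.Structure B] (f : A →[L] B) (θ : Congruence L B) :
    Congruence L A where
  toSetoid := θ.toSetoid.comap f
  map_fun g x y h := by
    change θ.toSetoid (f _) (f _)
    rw [f.map_fun, f.map_fun]
    exact θ.map_fun g _ _ h

/-- An auxiliary congruence: `a` and `b` are related if no unary polynomial function of `A`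
separates them with respect to membership in `F`. -/
def indiscernibility {A : Type u} [L.Structure A] (F : Set A) : Congruence L A where
  toSetoid :=
    { r := fun a b => ∀ t : L.Term (Option A),
        t.realize (fun o => o.getD a) ∈ F ↔ t.realize (fun o => o.getD b) ∈ F
      iseqv :=
        { refl := fun _ _ => Iff.rfl
          symm := fun h t => Iff.symm (h t)
          trans := by
            intro a b c h h' t
            exact Iff.trans (h t) (h' t) } }
  map_fun {n} f x y h := by
    classical
    have key : ∀ s : Finset (Fin n), ∀ t : L.Term (Option A),
        t.realize (fun o => o.getD (Structure.funMap f x)) ∈ F ↔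
          t.realize (fun o => o.getD (Structure.funMap f (s.piecewise y x))) ∈ F := by
      intro s
      induction s using Finset.induction_on with
      | empty => intro t; simp
      | insert i s hi ih =>
        intro t
        rw [ih t]
        let p : L.Term (Option A) := Term.func f fun j =>
          if j = i then Term.var none else Term.var (some (s.piecewise y x j))
        have hp : ∀ c, p.realize (fun o => o.getD c) =
            Structure.funMap f (Function.update (s.piecewise y x) i c) := by
          intro c
          simp only [p, Term.realize]
          congr 1
          funext j
          by_cases hj : j = i
          · subst hj; simp
          · simp [hj]
        let q : L.Term (Option A) := t.subst fun o => o.elim p fun a => Term.var (some a)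
        have hq : ∀ c, q.realize (fun o => o.getD c) = t.realize
            (fun o => o.getD (Structure.funMap f (Function.update (s.piecewise y x) i c))) := by
          intro c
          simp only [q, Term.realize_subst]
          congr 1
          funext o
          cases o with
          | none => simpa using hp c
          | some a => simp
        have := h i q
        rw [hq, hq] at this
        rw [Finset.piecewise_insert]
        have hx : Function.update (s.piecewise y x) i (x i) = s.piecewise y x := by
          rw [Function.update_eq_self_iff]
          simp [hi]
        rwa [hx] at this
    intro t
    simpa using key Finset.univ t

theorem realize_rel {A : Type u} [L.Structure A] (θ : Congruence L A) {α : Type*}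
    (t : L.Term α) (v w : α → A) (h : ∀ k, θ.toSetoid (v k) (w k)) :
    θ.toSetoid (t.realize v) (t.realize w) := by
  induction t with
  | var k => exact h k
  | func f ts ih => exact θ.map_fun f _ _ ih

/-- There is a greatest congruence compatible with a given subset. -/
theorem exists_isGreatest_compatible {A : Type u} [L.Structure A] (F : Set A) :
    ∃ θ : Congruence L A, IsGreatest {θ : Congruence L A | θ.Compatible F} θ := by
  refine ⟨indiscernibility F, fun a b ha h => ?_, fun θ hθ a b h t => ?_⟩
  · simpa using (h (Term.var none)).1 (by simpa using ha)
  · have h1 := θ.realize_rel t (fun o => o.getD a) (fun o => o.getD b)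
      (by rintro (_ | c); exacts [h, θ.toSetoid.refl c])
    exact ⟨fun h2 => hθ _ _ h2 h1, fun h2 => hθ _ _ h2 (θ.toSetoid.symm h1)⟩

end Congruence

variable (L) in
/-- The Leibniz operator: `leibniz L F` is the greatest congruence of `A` compatible with `F`. -/
noncomputable def leibniz {A : Type u} [L.Structure A] (F : Set A) : Congruence L A :=
  (Congruence.exists_isGreatest_compatible F).choose

variable (L) in
theorem leibniz_isGreatest {A : Type u} [L.Structure A] (F : Set A) :
    IsGreatest {θ : Congruence L A | θ.Compatible F} (leibniz L F) :=
  (Congruence.exists_isGreatest_compatible F).choose_spec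

/-! ### Consequence relations and logics -/

variable [L.IsAlgebraic]

variable (L) in
/-- A (finitary, structural) Tarskian consequence relation on a structure `A`. -/
structure ConsequenceRelation (A : Type u) [L.Structure A] where
  Entails : Set A → A → Prop
  refl : ∀ {Γ : Set A} {φ : A}, φ ∈ Γ → Entails Γ φ
  cut : ∀ {Γ Δ : Set A} {φ : A}, Entails Γ φ → (∀ ψ ∈ Γ, Entails Δ ψ) → Entails Δ φ
  mono : ∀ {Γ Δ : Set A} {φ : A}, Γ ⊆ Δ → Entails Γ φ → Entails Δ φ
  finitary : ∀ {Γ : Set A} {φ : A}, Entails Γ φ → ∃ Δ ⊆ Γ, Δ.Finite ∧ Entails Δ φ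
  structural : ∀ {Γ : Set A} {φ : A} (σ : A →[L] A), Entails Γ φ → Entails (σ '' Γ) (σ φ)

variable (L) in
/-- A logic with set of variables `X`: a consequence relation on the formula algebra. -/
abbrev Logic (X : Type u) := ConsequenceRelation L (L.Term X)

namespace Logic

variable {X : Type u} (l : Logic L X)

/-- `T` is a theory: a set of formulas closed under consequence. -/
def IsTheory (T : Set (L.Term X)) : Prop :=
  ∀ φ, l.Entails T φ → φ ∈ T

/-- `F ⊆ A` is an `l`-filter. -/
def IsFilter {A : Type u} [L.Structure A] (F : Set A) : Prop :=
  ∀ (Γ : Set (L.Term X)) (φ : L.Term X), l.Entails Γ φ →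
    ∀ v : L.Term X →[L] A, (∀ γ ∈ Γ, v γ ∈ F) → v φ ∈ F

/-- The poset `Fi_l(A)` of `l`-filters on `A`, ordered by inclusion. -/
abbrev Filters (A : Type u) [L.Structure A] := {F : Set A // l.IsFilter F}

/-- `l` is protoalgebraic. -/
def Protoalgebraic : Prop :=
  ∀ T : Set (L.Term X), l.IsTheory T → ∀ φ ψ : L.Term X, (leibniz L T).toSetoid φ ψ →
    l.Entails (insert φ T) ψ ∧ l.Entails (insert ψ T) φ

/-- `l` is truth-equational: the filters of its reduced matrices are equationally definable by
one set `τ` of equations in a single variable. -/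
def TruthEquational : Prop :=
  ∃ τ : Set (L.Term Unit × L.Term Unit), ∀ (A : Type u) [L.Structure A] (F : Set A),
    l.IsFilter F → (∀ a b, (leibniz L F).toSetoid a b ↔ a = b) →
      ∀ a : A, a ∈ F ↔ ∀ e ∈ τ, e.1.realize (fun _ => a) = e.2.realize (fun _ => a)

/-- `l` is weakly algebraizable. -/
def WeaklyAlgebraizable : Prop :=
  l.Protoalgebraic ∧ l.TruthEquational

/-- `Δ(x, y, z₀, z₁, …)` is a set of congruence formulas with parameters for `l`: on every
structure it defines the Leibniz congruence of every `l`-filter, the parameters `zₖ` being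
universally quantified. The variables `x`, `y` are `Sum.inl 0`, `Sum.inl 1`. -/
def IsCongruenceFormulas (Δ : Set (L.Term (Fin 2 ⊕ ℕ))) : Prop :=
  ∀ (A : Type u) [L.Structure A] (F : Set A), l.IsFilter F → ∀ a b : A,
    (leibniz L F).toSetoid a b ↔
      ∀ δ ∈ Δ, ∀ c : ℕ → A, δ.realize (Sum.elim ![a, b] c) ∈ F

/-- `l` is regularly weakly algebraizable: it is weakly algebraizable and has a set `Δ` of
congruence formulas with parameters that satisfies the rule (G), `x, y ⊢ Δ(x, y, z₀, z₁, …)`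
(stated for all substitution instances). -/
def RegularlyWeaklyAlgebraizable : Prop :=
  l.WeaklyAlgebraizable ∧ ∃ Δ : Set (L.Term (Fin 2 ⊕ ℕ)), l.IsCongruenceFormulas Δ ∧
    ∀ δ ∈ Δ, ∀ (φ ψ : L.Term X) (χ : ℕ → L.Term X),
      l.Entails {φ, ψ} (δ.subst (Sum.elim ![φ, ψ] χ))

/-- The Leibniz operator on the filters of `l`. -/
noncomputable def leibnizOnFilters (A : Type u) [L.Structure A] (F : l.Filters A) :
    Congruence L A :=
  leibniz L F.1

end Logic

/-! ### Congruence filter pairs -/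

/-- `P` is an algebraic lattice: a complete lattice in which every element is the join of the
compact elements below it. -/
structure IsAlgebraicLattice (P : Type*) [PartialOrder P] : Prop where
  exists_isGLB : ∀ S : Set P, ∃ x, IsGLB S x
  exists_isLUB : ∀ S : Set P, ∃ x, IsLUB S x
  isLUB_compact : ∀ x : P, IsLUB {c | IsCompactElement c ∧ c ≤ x} x

/-- The poset `Co_K(A)` of congruences of `A` whose quotient lies in the class `K`. -/
abbrev Co (K : Set (CategoryTheory.Bundled.{u} L.Structure)) (A : Type u) [L.Structure A] :=
  {θ : Congruence L A // θ.quotient ∈ K}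

/-- A congruence filter pair `(Co_K, i)`: the class `K` is such that `A ↦ Co_K(A)`, with inverse
images of congruences on homomorphisms, is a contravariant functor from structures to algebraic
lattices, and `i` is a natural family of maps from `Co_K(A)` to the subsets of `A` that preserve
arbitrary infima and directed suprema. -/
structure CongruenceFilterPair (K : Set (CategoryTheory.Bundled.{u} L.Structure)) where
  comap_mem : ∀ {A B : Type u} [L.Structure A] [L.Structure B] (f : A →[L] B)
    (θ : Congruence L B), θ.quotient ∈ K → (θ.comap f).quotient ∈ K
  comap_isGLB : ∀ {A B : Type u} [L.Structure A] [L.Structure B] (f : A →[L] B)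
    (S : Set (Co K B)) (θ : Co K B), IsGLB S θ →
      IsGLB ((fun η : Co K B => (⟨η.1.comap f, comap_mem f η.1 η.2⟩ : Co K A)) '' S)
        ⟨θ.1.comap f, comap_mem f θ.1 θ.2⟩
  comap_isLUB : ∀ {A B : Type u} [L.Structure A] [L.Structure B] (f : A →[L] B)
    (S : Set (Co K B)) (θ : Co K B), S.Nonempty → DirectedOn (· ≤ ·) S → IsLUB S θ →
      IsLUB ((fun η : Co K B => (⟨η.1.comap f, comap_mem f η.1 η.2⟩ : Co K A)) '' S)
        ⟨θ.1.comap f, comap_mem f θ.1 θ.2⟩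
  algebraic : ∀ (A : Type u) [L.Structure A], IsAlgebraicLattice (Co K A)
  i : ∀ (A : Type u) [L.Structure A], Co K A → Set A
  i_isGLB : ∀ (A : Type u) [L.Structure A] (S : Set (Co K A)) (θ : Co K A),
    IsGLB S θ → i A θ = ⋂ η ∈ S, i A η
  i_isLUB : ∀ (A : Type u) [L.Structure A] (S : Set (Co K A)) (θ : Co K A),
    S.Nonempty → DirectedOn (· ≤ ·) S → IsLUB S θ → i A θ = ⋃ η ∈ S, i A η
  natural : ∀ {A B : Type u} [L.Structure A] [L.Structure B] (f : A →[L] B) (θ : Co K B),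
    i A ⟨θ.1.comap f, comap_mem f θ.1 θ.2⟩ = f ⁻¹' i B θ

namespace CongruenceFilterPair

variable {K : Set (CategoryTheory.Bundled.{u} L.Structure)} (P : CongruenceFilterPair K)

/-- `i` is given by the set `τ` of equations in one variable: `i_A(θ)` is the set of those
`a ∈ A` with `⟨δ(a), ε(a)⟩ ∈ θ` for all `⟨δ, ε⟩ ∈ τ`. -/
def GivenBy (τ : Set (L.Term Unit × L.Term Unit)) : Prop :=
  ∀ (A : Type u) [L.Structure A] (θ : Co K A),
    P.i A θ = {a | ∀ e ∈ τ,
      θ.1.toSetoid (e.1.realize fun _ => a) (e.2.realize fun _ => a)}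

theorem i_mono (A : Type u) [L.Structure A] : Monotone (P.i A) := by
  intro θ η h
  have := P.i_isGLB A {θ, η} θ ⟨by rintro x (rfl | rfl); exacts [le_rfl, h],
    fun x hx => hx (by simp)⟩
  rw [this]
  exact Set.biInter_subset_of_mem (by simp)

/-- The consequence relation on `A` associated with the filter pair:
`Γ ⊢ φ` iff every set `i_A(θ)` that contains `Γ` contains `φ`. -/
def consequence (A : Type u) [L.Structure A] : ConsequenceRelation L A where
  Entails Γ φ := ∀ θ : Co K A, Γ ⊆ P.i A θ → φ ∈ P.i A θ
  refl h _ hθ := hθ h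
  cut h h' θ hθ := h θ fun ψ hψ => h' ψ hψ θ hθ
  mono h h' θ hθ := h' θ (h.trans hθ)
  finitary {Γ φ} h := by
    choose g hg using fun Δ : Set A => (P.algebraic A).exists_isGLB {θ | Δ ⊆ P.i A θ}
    have hsub : ∀ Δ, Δ ⊆ P.i A (g Δ) := by
      intro Δ
      rw [P.i_isGLB A _ _ (hg Δ)]
      exact Set.subset_iInter₂ fun η hη => hη
    have hmono : ∀ Δ Δ', Δ ⊆ Δ' → g Δ ≤ g Δ' := fun Δ Δ' hd =>
      (hg Δ).1 (hd.trans (hsub Δ'))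
    let S : Set (Co K A) := g '' {Δ | Δ ⊆ Γ ∧ Δ.Finite}
    have hne : S.Nonempty := ⟨_, ∅, ⟨Set.empty_subset _, Set.finite_empty⟩, rfl⟩
    have hdir : DirectedOn (· ≤ ·) S := by
      rintro _ ⟨Δ, hΔ, rfl⟩ _ ⟨Δ', hΔ', rfl⟩
      exact ⟨_, ⟨Δ ∪ Δ', ⟨Set.union_subset hΔ.1 hΔ'.1, hΔ.2.union hΔ'.2⟩, rfl⟩,
        hmono _ _ Set.subset_union_left, hmono _ _ Set.subset_union_right⟩
    obtain ⟨z, hz⟩ := (P.algebraic A).exists_isLUB S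
    have hφ := h z (by
      intro γ hγ
      exact P.i_mono A (hz.1 ⟨{γ}, ⟨by simpa using hγ, Set.finite_singleton γ⟩, rfl⟩)
        (hsub {γ} rfl))
    rw [P.i_isLUB A S z hne hdir hz] at hφ
    simp only [Set.mem_iUnion] at hφ
    obtain ⟨_, ⟨Δ, hΔ, rfl⟩, hφ⟩ := hφ
    exact ⟨Δ, hΔ.1, hΔ.2, fun θ hθ => P.i_mono A ((hg Δ).1 hθ) hφ⟩
  structural {Γ φ} σ h θ hθ := by
    have := h ⟨θ.1.comap σ, P.comap_mem σ θ.1 θ.2⟩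
      (by rw [P.natural]; exact Set.image_subset_iff.1 hθ)
    rwa [P.natural] at this

/-- The logic with set of variables `X` associated with the filter pair. -/
abbrev logic (X : Type u) : Logic L X := P.consequence (L.Term X)

/-- The sets `i_A(θ)` are filters of the associated logic. -/
theorem isFilter_i (X : Type u) (A : Type u) [L.Structure A] (θ : Co K A) :
    Logic.IsFilter (P.logic X) (P.i A θ) := by
  intro Γ φ h v hv
  have := h ⟨θ.1.comap v, P.comap_mem v θ.1 θ.2⟩ (by rw [P.natural]; exact hv)
  rwa [P.natural] at this

/-- The map `i_A` from `Co_K(A)` to the filters on `A` of the associated logic. -/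
def toFilters (X : Type u) (A : Type u) [L.Structure A] (θ : Co K A) :
    Logic.Filters (P.logic X) A :=
  ⟨P.i A θ, P.isFilter_i X A θ⟩

/-- `i` is left adjoint to the Leibniz operator: on every structure `A`,
`i_A(θ) ⊆ F ↔ θ ⊆ Ω_A(F)` for all `θ ∈ Co_K(A)` and all filters `F`. As `Ω_A(F)` need not lie in
`Co_K(A)` for a general `K`, the right-hand inclusion is taken among all congruences of `A`. -/
def LeftAdjointToLeibniz (X : Type u) : Prop :=
  ∀ (A : Type u) [L.Structure A] (θ : Co K A) (F : Logic.Filters (P.logic X) A),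
    P.toFilters X A θ ≤ F ↔ θ.1 ≤ Logic.leibnizOnFilters (P.logic X) A F

end CongruenceFilterPair

end AAL

/-!
The argument rests on two facts about the logic `l` of the filter pair.

* Every `l`-filter on an absolutely free structure, over any nonempty set of variables `Y`, has the
  form `i(θ)` (`exists_i_eq_of_isFilter`). Indeed `l` is finitary and `X` is infinite, so every
  consequence over `Y` is a renaming of a consequence over `X`. Since every structure is a quotient
  of an absolutely free one, and the Leibniz operator commutes with inverse images along surjective
  homomorphisms, statements about filters on arbitrary structures can be checked on filters `i(θ)`.
* The candidate congruence formulas are `Logic.diagonalFormulas`, the formulas `δ(x, y, z̄)` such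
  that `δ(x, x, z̄)` is a theorem. They always satisfy the rule `x, y ⊢ δ(x, y, z̄)`, because
  `x` and `y` are both identified with `⊤` by any `θ` such that `i(θ)` contains them.

If `i` is left adjoint to `Ω`, let `σ` be the substitution `y ↦ x` and `θ` the inverse image under
`σ` of the least congruence in `Co_K`. Then `i(θ)` consists of the diagonal formulas, and `x θ y`.
Hence a filter `F` that contains all `δ(a, b, c̄)` pulls back to a filter containing `i(θ)`, whose
Leibniz congruence then relates `x` and `y`, so `Ω(F)` relates `a` and `b`. Thus the diagonal
formulas define `Ω`, which makes `Ω` monotone and `l` protoalgebraic. Moreover a filter `i(θ)` is a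
single class of `θ ≤ Ω(i(θ))`, so reduced filters are `{⊤}` and `l` is truth-equational.

Conversely, let `Δ` be congruence formulas, `i(θ) ⊆ F` and `a θ b`. Then `δ(a, a, c̄)` lies in the
filter `i(θ)`, hence so does the `θ`-related element `δ(a, b, c̄)`, which therefore lies in `F`.
-/

namespace AAL

variable {L : FirstOrder.Language.{u, v}}

/-! ### The Leibniz congruence -/

section Leibniz

variable {A : Type u} [L.Structure A] {F : Set A}

theorem leibniz_compatible (F : Set A) : (leibniz L F).Compatible F :=
  (leibniz_isGreatest L F).1

theorem Congruence.Compatible.le_leibniz {θ : Congruence L A} (h : θ.Compatible F) :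
    θ ≤ leibniz L F :=
  (leibniz_isGreatest L F).2 h

/-- A pair is in the Leibniz congruence as soon as no unary polynomial separates it. -/
theorem leibniz_of_forall_realize {a b : A}
    (h : ∀ t : L.Term (Option A), t.realize (fun o => o.getD a) ∈ F ↔
      t.realize (fun o => o.getD b) ∈ F) : (leibniz L F).toSetoid a b := by
  have hc : (Congruence.indiscernibility (L := L) F).Compatible F := fun a b ha h => by
    simpa using (h (Term.var none)).1 (by simpa using ha)
  exact hc.le_leibniz h

/-- Surjective homomorphisms map the Leibniz congruence of `f⁻¹(F)` into that of `F`. -/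
theorem leibniz_of_leibniz_preimage {B : Type u} [L.Structure B] [L.IsAlgebraic] (f : B →[L] A)
    (hf : Function.Surjective f) {x y : B} (h : (leibniz L (f ⁻¹' F)).toSetoid x y) :
    (leibniz L F).toSetoid (f x) (f y) := by
  refine leibniz_of_forall_realize fun t => ?_
  obtain ⟨s, hs⟩ := hf.hasRightInverse
  let q : B → B := fun z => t.realize fun o => (o.map s).getD z
  have hq : ∀ z, f (q z) = t.realize fun o => o.getD (f z) := fun z => by
    rw [← FirstOrder.Language.HomClass.realize_term]
    congr 1
    funext o
    cases o with
    | none => rfl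
    | some a => exact hs a
  have hrel : (leibniz L (f ⁻¹' F)).toSetoid (q x) (q y) :=
    Congruence.realize_rel _ t _ _ (by
      rintro (_ | c)
      exacts [h, Setoid.refl' _ _])
  rw [← hq, ← hq]
  exact ⟨fun h' => leibniz_compatible (f ⁻¹' F) _ _ h' hrel,
    fun h' => leibniz_compatible (f ⁻¹' F) _ _ h' (Setoid.symm' _ hrel)⟩

end Leibniz

/-! ### Values of terms and absolutely free structures -/

theorem Congruence.realize_pair_rel {A : Type u} [L.Structure A] (θ : Congruence L A) {a b : A}
    (h : θ.toSetoid a b) (δ : L.Term (Fin 2 ⊕ ℕ)) (c : ℕ → A) :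
    θ.toSetoid (δ.realize (Sum.elim ![a, a] c)) (δ.realize (Sum.elim ![a, b] c)) := by
  refine θ.realize_rel δ _ _ ?_
  rintro (k | k)
  · fin_cases k
    · exact Setoid.refl' _ _
    · exact h
  · exact Setoid.refl' _ _

theorem realize_congr {α : Type*} [DecidableEq α] {A : Type*} [L.Structure A] (t : L.Term α)
    {v w : α → A} (h : ∀ k ∈ t.varFinset, v k = w k) : t.realize v = t.realize w := by
  induction t with
  | var k => exact h k (by simp)
  | func f ts ih =>
    exact congrArg (Structure.funMap f) (funext fun j => ih j fun k hk =>
      h k (Finset.mem_biUnion.2 ⟨j, Finset.mem_univ j, hk⟩))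

variable [L.IsAlgebraic]

/-- The homomorphism from the absolutely free structure that extends an assignment of the
variables. -/
def evalHom {Y A : Type u} [L.Structure A] (v : Y → A) : L.Term Y →[L] A where
  toFun t := t.realize v
  map_fun' _ _ := rfl
  map_rel' r _ := isEmptyElim r

@[simp]
theorem evalHom_apply {Y A : Type u} [L.Structure A] (v : Y → A) (t : L.Term Y) :
    evalHom v t = t.realize v := rfl

theorem realize_eq_subst {α : Type*} {Y : Type u} (t : L.Term α) (v : α → L.Term Y) :
    t.realize v = t.subst v := by
  induction t with
  | var => rfl
  | func f ts ih => exact congrArg (Term.func f) (funext ih)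

theorem exists_leftInverse_on_finset {Y X : Type*} [Infinite X] [Nonempty Y] (s : Finset Y) :
    ∃ (g : Y → X) (g' : X → Y), ∀ k ∈ s, g' (g k) = k := by
  classical
  obtain ⟨e⟩ : Nonempty (s ↪ X) :=
    ⟨(Finset.equivFin s).toEmbedding.trans
      (Fin.valEmbedding.trans (Infinite.natEmbedding X))⟩
  let g : Y → X := fun k => if h : k ∈ s then e ⟨k, h⟩ else Classical.arbitrary X
  have hg : Set.InjOn g s := by
    intro a ha b hb h
    have ha' : a ∈ s := ha
    have hb' : b ∈ s := hb
    simp only [g, dif_pos ha', dif_pos hb'] at h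
    exact congrArg Subtype.val (e.injective h)
  exact ⟨g, Function.invFunOn g s, fun k hk => hg.leftInvOn_invFunOn hk⟩

namespace Logic

variable {X : Type u} {l : Logic L X}

theorem IsFilter.preimage {A B : Type u} [L.Structure A] [L.Structure B] {F : Set B}
    (hF : l.IsFilter F) (f : A →[L] B) : l.IsFilter (f ⁻¹' F) :=
  fun Γ φ h v hv => hF Γ φ h (f.comp v) hv

theorem IsTheory.isFilter {T : Set (L.Term X)} (hT : l.IsTheory T) : l.IsFilter T :=
  fun _ _ h v hv => hT _ (l.mono (Set.image_subset_iff.2 hv) (l.structural v h))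

variable (l) in
/-- The formulas `δ(x, y, z̄)` such that `δ(x, x, z̄)` is a theorem. Being a theorem is expressed
semantically, as membership in every filter under every assignment, so that no embedding of the
variables `x, y, z₀, z₁, …` into `X` has to be chosen. -/
def diagonalFormulas : Set (L.Term (Fin 2 ⊕ ℕ)) :=
  {δ | ∀ (A : Type u) [L.Structure A] (F : Set A), l.IsFilter F → ∀ (a : A) (c : ℕ → A),
    δ.realize (Sum.elim ![a, a] c) ∈ F}

/-- Congruence formulas with parameters make the Leibniz operator monotone on filters. -/
theorem IsCongruenceFormulas.monotone_leibniz {Δ : Set (L.Term (Fin 2 ⊕ ℕ))}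
    (hΔ : l.IsCongruenceFormulas Δ) (A : Type u) [L.Structure A] :
    Monotone (leibnizOnFilters l A) := fun F G hFG a b h =>
  (hΔ A G.1 G.2 a b).2 fun δ hδ c => hFG ((hΔ A F.1 F.2 a b).1 h δ hδ c)

end Logic

namespace CongruenceFilterPair

variable {K : Set (CategoryTheory.Bundled.{u} L.Structure)} {P : CongruenceFilterPair K}
  {X : Type u}

/-! ### Filters on absolutely free structures -/

/-- Consequences over the variables `Y` hold in all filters of the logic with variables in `X`:
by finitarity only finitely many variables occur, and these can be renamed into `X` and back. -/
theorem mem_of_consequence_term [Infinite X] {Y : Type u} [Nonempty Y] {F : Set (L.Term Y)}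
    (hF : Logic.IsFilter (P.logic X) F) {φ : L.Term Y}
    (h : (P.consequence (L.Term Y)).Entails F φ) : φ ∈ F := by
  classical
  obtain ⟨Γ, hΓF, hΓ, hφ⟩ := (P.consequence (L.Term Y)).finitary h
  obtain ⟨g, g', hg⟩ := exists_leftInverse_on_finset (X := X)
    (φ.varFinset ∪ hΓ.toFinset.biUnion fun γ => γ.varFinset)
  let σ : L.Term Y →[L] L.Term X := evalHom fun k => Term.var (g k)
  let ρ : L.Term X →[L] L.Term Y := evalHom fun k => Term.var (g' k)
  have hρσ : ∀ t : L.Term Y, (∀ k ∈ t.varFinset, g' (g k) = k) → ρ (σ t) = t := by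
    intro t ht
    calc ρ (σ t) = t.realize fun k => ρ (Term.var (g k)) :=
          (FirstOrder.Language.HomClass.realize_term ρ).symm
      _ = t.realize Term.var := realize_congr t fun k hk => congrArg Term.var (ht k hk)
      _ = t := by
        clear ht
        induction t with
        | var => rfl
        | func f ts ih => exact congrArg (Term.func f) (funext ih)
  have hσ : (P.logic X).Entails (σ '' Γ) (σ φ) := fun θ hθ => by
    have := hφ ⟨θ.1.comap σ, P.comap_mem σ θ.1 θ.2⟩
      (by rw [P.natural]; exact Set.image_subset_iff.1 hθ)
    rwa [P.natural] at this
  have := hF _ _ hσ ρ (by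
    rintro _ ⟨γ, hγ, rfl⟩
    rw [hρσ γ fun k hk => hg k (Finset.mem_union_right _
      (Finset.mem_biUnion.2 ⟨γ, hΓ.mem_toFinset.2 hγ, hk⟩))]
    exact hΓF hγ)
  rwa [hρσ φ fun k hk => hg k (Finset.mem_union_left _ hk)] at this

/-- Every filter on an absolutely free structure is in the image of `i`. -/
theorem exists_i_eq_of_isFilter [Infinite X] {Y : Type u} [Nonempty Y] {F : Set (L.Term Y)}
    (hF : Logic.IsFilter (P.logic X) F) : ∃ θ : Co K (L.Term Y), P.i _ θ = F := by
  obtain ⟨θ, hθ⟩ := (P.algebraic (L.Term Y)).exists_isGLB {θ | F ⊆ P.i _ θ}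
  refine ⟨θ, Set.Subset.antisymm (fun φ hφ => mem_of_consequence_term hF fun η hη =>
    P.i_mono _ (hθ.1 hη) hφ) ?_⟩
  rw [P.i_isGLB _ _ _ hθ]
  exact Set.subset_iInter₂ fun η hη => hη

/-! ### Truth defined by a constant -/

section Constant

variable {top : L.Constants} {A : Type u} [L.Structure A]

theorem GivenBy.mem_i (hP : P.GivenBy {(Term.var (), Constants.term top)}) {θ : Co K A} {a : A} :
    a ∈ P.i A θ ↔ θ.1.toSetoid a (top : A) := by
  rw [hP A θ]
  simp

theorem GivenBy.compatible_i (hP : P.GivenBy {(Term.var (), Constants.term top)}) (θ : Co K A) :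
    θ.1.Compatible (P.i A θ) := fun _ _ ha hab =>
  hP.mem_i.2 (Setoid.trans' _ (Setoid.symm' _ hab) (hP.mem_i.1 ha))

theorem GivenBy.top_mem (hP : P.GivenBy {(Term.var (), Constants.term top)}) {F : Set A}
    (hF : Logic.IsFilter (P.logic X) F) : (top : A) ∈ F := by
  -- `⊤` is a theorem of the logic, and the value of a homomorphism at it is `⊤`.
  have h : (P.logic X).Entails ∅ (Constants.term top) := fun θ _ =>
    hP.mem_i.2 (Setoid.refl' _ _)
  have := hF ∅ _ h (evalHom fun _ => (top : A)) (by simp)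
  simpa using this

/-- The inclusion `i(θ) ⊆ F` follows from `θ ⊆ Ω(F)` without any assumption on the logic, because
`i(θ)` is the class of `⊤ ∈ F`. -/
theorem GivenBy.i_subset_of_le_leibniz (hP : P.GivenBy {(Term.var (), Constants.term top)})
    {F : Set A} (hF : Logic.IsFilter (P.logic X) F) {θ : Co K A} (h : θ.1 ≤ leibniz L F) :
    P.i A θ ⊆ F := fun _ ha =>
  leibniz_compatible F _ _ (hP.top_mem hF) (Setoid.symm' _ (h (hP.mem_i.1 ha)))

/-! ### From congruence formulas to adjointness -/

theorem GivenBy.leftAdjoint_of_isCongruenceFormulas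
    (hP : P.GivenBy {(Term.var (), Constants.term top)}) {Δ : Set (L.Term (Fin 2 ⊕ ℕ))}
    (hΔ : Logic.IsCongruenceFormulas (P.logic X) Δ) : P.LeftAdjointToLeibniz X := by
  intro A _ θ F
  refine ⟨fun h a b hab => (hΔ A F.1 F.2 a b).2 fun δ hδ c => h ?_,
    hP.i_subset_of_le_leibniz F.2⟩
  exact hP.compatible_i θ _ _
    ((hΔ A _ (P.isFilter_i X A θ) a a).1 (Setoid.refl' _ a) δ hδ c)
    (θ.1.realize_pair_rel hab δ c)

/-! ### From adjointness to regular weak algebraizability -/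

/-- Under adjointness, any two elements of a filter are identified by its Leibniz congruence. -/
theorem GivenBy.leibniz_of_mem [Infinite X]
    (hP : P.GivenBy {(Term.var (), Constants.term top)}) (hadj : P.LeftAdjointToLeibniz X)
    {F : Set A} (hF : Logic.IsFilter (P.logic X) F) {a b : A} (ha : a ∈ F) (hb : b ∈ F) :
    (leibniz L F).toSetoid a b := by
  have : Nonempty A := ⟨a⟩
  let f : L.Term A →[L] A := evalHom id
  have hf : Function.Surjective f := fun c => ⟨Term.var c, rfl⟩
  obtain ⟨θ, hθ⟩ := exists_i_eq_of_isFilter (hF.preimage f)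
  have hle : θ.1 ≤ leibniz L (f ⁻¹' F) :=
    (hadj _ θ ⟨_, hF.preimage f⟩).1 hθ.subset
  have hmem : ∀ c ∈ F, θ.1.toSetoid (Term.var c) (top : L.Term A) := fun c hc =>
    hP.mem_i.1 (hθ.superset hc)
  exact leibniz_of_leibniz_preimage f hf (x := Term.var a) (y := Term.var b)
    (hle (Setoid.trans' _ (hmem a ha) (Setoid.symm' _ (hmem b hb))))

/-- Under adjointness the diagonal formulas define the Leibniz congruence of every filter. -/
theorem LeftAdjointToLeibniz.isCongruenceFormulas_diagonal [Infinite X]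
    (hadj : P.LeftAdjointToLeibniz X) :
    Logic.IsCongruenceFormulas (P.logic X) (Logic.diagonalFormulas (P.logic X)) := by
  classical
  intro A _ F hF a b
  refine ⟨fun h δ hδ c => leibniz_compatible F _ _ (hδ A F hF a c)
    ((leibniz L F).realize_pair_rel h δ c), fun h => ?_⟩
  have : Nonempty A := ⟨a⟩
  -- The variables are `x`, `y` and one parameter for each element of `A`; the substitution `σ`
  -- replaces `y` by `x`, and `f` interprets `x, y` as `a, b`.
  let x : L.Term (Fin 2 ⊕ A) := Term.var (Sum.inl 0)
  let y : L.Term (Fin 2 ⊕ A) := Term.var (Sum.inl 1)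
  let σ : L.Term (Fin 2 ⊕ A) →[L] L.Term (Fin 2 ⊕ A) :=
    evalHom (Sum.elim ![x, x] fun c => Term.var (Sum.inr c))
  let f : L.Term (Fin 2 ⊕ A) →[L] A := evalHom (Sum.elim ![a, b] id)
  have hf : Function.Surjective f := fun c => ⟨Term.var (Sum.inr c), rfl⟩
  obtain ⟨θ₀, hθ₀⟩ := (P.algebraic (L.Term (Fin 2 ⊕ A))).exists_isGLB Set.univ
  let θ : Co K (L.Term (Fin 2 ⊕ A)) := ⟨θ₀.1.comap σ, P.comap_mem σ θ₀.1 θ₀.2⟩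
  have hsub : P.i _ θ ⊆ f ⁻¹' F := by
    intro φ hφ
    rw [P.natural] at hφ
    -- Only finitely many parameters occur in `φ`, so they can be taken among `z₀, z₁, …`.
    obtain ⟨g, g', hg⟩ := exists_leftInverse_on_finset (X := ℕ)
      (φ.varFinset.preimage Sum.inr Sum.inr_injective.injOn)
    have hδ : φ.relabel (Sum.map id g) ∈ Logic.diagonalFormulas (P.logic X) := by
      intro B _ G hG e c
      let k : L.Term (Fin 2 ⊕ A) →[L] B := evalHom (Sum.elim ![e, e] (c ∘ g))
      obtain ⟨η, hη⟩ := exists_i_eq_of_isFilter (hG.preimage k)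
      have hk : k (σ φ) ∈ G := hη.subset (P.i_mono _ (hθ₀.1 (Set.mem_univ η)) hφ)
      have hkσ : k (σ φ) = φ.realize (Sum.elim ![e, e] (c ∘ g)) := by
        refine (FirstOrder.Language.HomClass.realize_term k).symm.trans ?_
        congr 1
        funext j
        rcases j with j | j
        · fin_cases j <;> rfl
        · rfl
      rw [hkσ] at hk
      rw [FirstOrder.Language.Term.realize_relabel, Sum.elim_comp_map]
      exact hk
    have := h _ hδ g'
    rw [FirstOrder.Language.Term.realize_relabel, Sum.elim_comp_map] at this
    have heq : φ.realize (Sum.elim (![a, b] ∘ id) (g' ∘ g)) = f φ := by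
      refine realize_congr φ fun j hj => ?_
      rcases j with j | j
      · rfl
      · exact hg j (by simpa using hj)
    rwa [heq] at this
  have hle : θ.1 ≤ leibniz L (f ⁻¹' F) := (hadj _ θ ⟨_, hF.preimage f⟩).1 hsub
  exact leibniz_of_leibniz_preimage f hf (x := x) (y := y)
    (hle (show θ₀.1.toSetoid x x from Setoid.refl' _ _))

/-- The diagonal formulas satisfy the rule `x, y ⊢ δ(x, y, z̄)`. -/
theorem GivenBy.entails_diagonal (hP : P.GivenBy {(Term.var (), Constants.term top)})
    {δ : L.Term (Fin 2 ⊕ ℕ)} (hδ : δ ∈ Logic.diagonalFormulas (P.logic X)) (φ ψ : L.Term X)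
    (χ : ℕ → L.Term X) : (P.logic X).Entails {φ, ψ} (δ.subst (Sum.elim ![φ, ψ] χ)) := by
  intro θ hθ
  have hφψ : θ.1.toSetoid φ ψ := Setoid.trans' _ (hP.mem_i.1 (hθ (by simp)))
    (Setoid.symm' _ (hP.mem_i.1 (hθ (by simp))))
  rw [← realize_eq_subst]
  exact hP.compatible_i θ _ _ (hδ _ _ (P.isFilter_i X _ θ) φ χ)
    (θ.1.realize_pair_rel hφψ δ χ)

theorem LeftAdjointToLeibniz.monotone_leibniz [Infinite X] (hadj : P.LeftAdjointToLeibniz X)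
    (A : Type u) [L.Structure A] : Monotone (Logic.leibnizOnFilters (P.logic X) A) :=
  hadj.isCongruenceFormulas_diagonal.monotone_leibniz A

theorem LeftAdjointToLeibniz.protoalgebraic [Infinite X] (hadj : P.LeftAdjointToLeibniz X) :
    Logic.Protoalgebraic (P.logic X) := by
  have key : ∀ T : Set (L.Term X), Logic.IsTheory (P.logic X) T → ∀ φ ψ : L.Term X,
      (leibniz L T).toSetoid φ ψ → (P.logic X).Entails (insert φ T) ψ := by
    intro T hT φ ψ h θ hθ
    have hle : leibniz L T ≤ leibniz L (P.i _ θ) :=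
      hadj.monotone_leibniz _ (a := ⟨T, hT.isFilter⟩) (b := P.toFilters X _ θ)
        ((Set.subset_insert _ _).trans hθ)
    exact leibniz_compatible _ _ _ (hθ (Set.mem_insert _ _)) (hle h)
  exact fun T hT φ ψ h => ⟨key T hT φ ψ h, key T hT ψ φ (Setoid.symm' _ h)⟩

theorem GivenBy.truthEquational [Infinite X]
    (hP : P.GivenBy {(Term.var (), Constants.term top)}) (hadj : P.LeftAdjointToLeibniz X) :
    Logic.TruthEquational (P.logic X) := by
  refine ⟨{(Term.var (), Constants.term top)}, fun A _ F hF hred a => ?_⟩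
  simp only [Set.mem_singleton_iff, forall_eq, FirstOrder.Language.Term.realize_var,
    FirstOrder.Language.Term.realize_constants]
  exact ⟨fun ha => (hred _ _).1 (hP.leibniz_of_mem hadj hF ha (hP.top_mem hF)),
    fun ha => ha ▸ hP.top_mem hF⟩

theorem GivenBy.regularlyWeaklyAlgebraizable_iff [Infinite X]
    (hP : P.GivenBy {(Term.var (), Constants.term top)}) :
    Logic.RegularlyWeaklyAlgebraizable (P.logic X) ↔ P.LeftAdjointToLeibniz X :=
  ⟨fun ⟨_, _, hΔ, _⟩ => hP.leftAdjoint_of_isCongruenceFormulas hΔ,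
    fun hadj => ⟨⟨hadj.protoalgebraic, hP.truthEquational hadj⟩, _,
      hadj.isCongruenceFormulas_diagonal, fun _ hδ => hP.entails_diagonal hδ⟩⟩

end Constant

end CongruenceFilterPair

end AAL

theorem theorem4p14 {L : FirstOrder.Language.{u, v}} [L.IsAlgebraic] (top : L.Constants)
    (K : Set (CategoryTheory.Bundled.{u} L.Structure)) (P : AAL.CongruenceFilterPair K)
    (hP : P.GivenBy {(Term.var (), Constants.term top)}) (X : Type u) [Infinite X] :
    (AAL.Logic.RegularlyWeaklyAlgebraizable (P.logic X) ↔ P.LeftAdjointToLeibniz X) ∧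
    (P.LeftAdjointToLeibniz X → ∀ (A : Type u) [L.Structure A],
      Monotone (P.toFilters X A) ∧ Monotone (AAL.Logic.leibnizOnFilters (P.logic X) A)) ∧
    (∀ hΩ : ∀ (A : Type u) [L.Structure A] (F : AAL.Logic.Filters (P.logic X) A),
        (AAL.Logic.leibnizOnFilters (P.logic X) A F).quotient ∈ K,
      AAL.Logic.RegularlyWeaklyAlgebraizable (P.logic X) ↔
        ∀ (A : Type u) [L.Structure A], GaloisConnection (P.toFilters X A)
          (fun F => (⟨AAL.Logic.leibnizOnFilters (P.logic X) A F, hΩ A F⟩ : AAL.Co K A))) := by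
  refine ⟨hP.regularlyWeaklyAlgebraizable_iff, fun hadj A _ =>
    ⟨P.i_mono A, hadj.monotone_leibniz A⟩, fun hΩ => ?_⟩
  rw [hP.regularlyWeaklyAlgebraizable_iff]
  exact Iff.rfl
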